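/- Let $X$ be a real Banach space, $F$ a real Banach lattice, and $T\colon X\to F$ a bounded linear operator with adjoint $T'\colon F'\to X'$, $T'f=f\circ T$. A bounded set $A\subseteq X$ is called limited if every weak$^*$-null sequence in $X'$ converges to $0$ uniformly on $A$. A set $B\subseteq F$ is called an Lwc-set if every disjoint sequence in its solid hull $\operatorname{sol}(B)=\{y\in F:\ |y|\le |b|\text{ for some } b\in B\}$ converges to $0$ in norm. Here a sequence $(a_n)$ in a vector lattice is disjoint if $|a_m|\wedge|a_n|=0$ whenever $m\neq n$, and $F'$ carries its dual order: $f\le g$ if and only if $f(x)\le g(x)$ for all $x\ge 0$ in $F$. Then $T(A)$ is an Lwc-set for every limited set $A\subseteq X$ (that is, $T$ is limitedly L-weakly compact) if and only if $T'f_n\to 0$ in the weak$^*$ topology of $X'$ for every disjoint norm-bounded sequence $(f_n)$ in $F'$. -/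

import Mathlib

open Filter Topology

/-! ### The order dual of a Banach lattice

For a normed lattice `F`, the norm dual `F'` is ordered by `f ≤ g ↔ f x ≤ g x` for all `x ≥ 0`.
The positive part of `h ∈ F'` is given on the positive cone by the Riesz-Kantorovich formula
`h⁺ x = sup {h y : 0 ≤ y ≤ x}`; this makes `F'` a vector lattice. -/

section OrderDual

set_option linter.unusedSectionVars false

variable {F : Type*} [NormedAddCommGroup F] [NormedSpace ℝ F] [Lattice F] [HasSolidNorm F]
  [IsOrderedAddMonoid F] [IsOrderedModule ℝ F]

/-- The Riesz-Kantorovich supremum `sup {h y : 0 ≤ y ≤ x}` (used for `x ≥ 0`). -/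
noncomputable def rieszSup (h : StrongDual ℝ F) (x : F) : ℝ := sSup (h '' Set.Icc 0 x)


theorem apply_le_norm_mul (h : StrongDual ℝ F) {x y : F} (hy : 0 ≤ y) (hyx : y ≤ x) :
    h y ≤ ‖h‖ * ‖x‖ := by
  have h1 : ‖y‖ ≤ ‖x‖ := norm_le_norm_of_abs_le_abs (by
    rw [abs_of_nonneg hy, abs_of_nonneg (hy.trans hyx)]; exact hyx)
  calc h y ≤ ‖h y‖ := Real.le_norm_self _
    _ ≤ ‖h‖ * ‖y‖ := h.le_opNorm y
    _ ≤ ‖h‖ * ‖x‖ := by gcongr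

theorem le_rieszSup (h : StrongDual ℝ F) {x y : F} (hy : 0 ≤ y) (hyx : y ≤ x) :
    h y ≤ rieszSup h x := by
  refine le_csSup ⟨‖h‖ * ‖x‖, ?_⟩ ⟨y, ⟨hy, hyx⟩, rfl⟩
  rintro _ ⟨z, hz, rfl⟩
  exact apply_le_norm_mul h hz.1 hz.2

theorem rieszSup_le (h : StrongDual ℝ F) {x : F} (hx : 0 ≤ x) {c : ℝ}
    (hc : ∀ y, 0 ≤ y → y ≤ x → h y ≤ c) : rieszSup h x ≤ c := by
  refine csSup_le ⟨h 0, 0, ⟨le_rfl, hx⟩, rfl⟩ ?_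
  rintro _ ⟨z, hz, rfl⟩
  exact hc z hz.1 hz.2

theorem rieszSup_nonneg (h : StrongDual ℝ F) {x : F} (hx : 0 ≤ x) : 0 ≤ rieszSup h x := by
  simpa using le_rieszSup h le_rfl hx

theorem rieszSup_add (h : StrongDual ℝ F) {x y : F} (hx : 0 ≤ x) (hy : 0 ≤ y) :
    rieszSup h (x + y) = rieszSup h x + rieszSup h y := by
  apply le_antisymm
  · refine rieszSup_le h (add_nonneg hx hy) fun z hz hzxy => ?_
    have h1 : h (z ⊓ x) ≤ rieszSup h x := le_rieszSup h (le_inf hz hx) inf_le_right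
    have h2 : h (z - z ⊓ x) ≤ rieszSup h y := by
      refine le_rieszSup h (sub_nonneg.2 inf_le_left) ?_
      rw [sub_le_comm]
      exact le_inf (sub_le_self z hy) (sub_le_iff_le_add.2 hzxy)
    rw [map_sub] at h2
    linarith
  · rw [← le_sub_iff_add_le]
    refine rieszSup_le h hx fun u hu hux => ?_
    rw [le_sub_comm]
    refine rieszSup_le h hy fun v hv hvy => ?_
    rw [le_sub_iff_add_le, add_comm, ← map_add]
    exact le_rieszSup h (add_nonneg hu hv) (add_le_add hux hvy)

theorem rieszSup_smul_le (h : StrongDual ℝ F) {c : ℝ} (hc : 0 < c) {x : F} (hx : 0 ≤ x) :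
    rieszSup h (c • x) ≤ c * rieszSup h x := by
  refine rieszSup_le h (smul_nonneg hc.le hx) fun y hy hyx => ?_
  have h1 : h (c⁻¹ • y) ≤ rieszSup h x := by
    refine le_rieszSup h (smul_nonneg (inv_nonneg.2 hc.le) hy) ?_
    have := smul_le_smul_of_nonneg_left hyx (inv_nonneg.2 hc.le)
    rwa [inv_smul_smul₀ hc.ne'] at this
  rw [map_smul, smul_eq_mul, inv_mul_le_iff₀ hc] at h1
  exact h1

theorem rieszSup_smul (h : StrongDual ℝ F) {c : ℝ} (hc : 0 < c) {x : F} (hx : 0 ≤ x) :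
    rieszSup h (c • x) = c * rieszSup h x := by
  refine le_antisymm (rieszSup_smul_le h hc hx) ?_
  have := rieszSup_smul_le h (inv_pos.2 hc) (smul_nonneg hc.le hx)
  rwa [inv_smul_smul₀ hc.ne', ← div_eq_inv_mul, le_div_iff₀' hc] at this

theorem rieszSup_posPart_sub (h : StrongDual ℝ F) {x a b : F} (ha : 0 ≤ a) (hb : 0 ≤ b)
    (hx : x = a - b) : rieszSup h x⁺ - rieszSup h x⁻ = rieszSup h a - rieszSup h b := by
  have h1 : x⁺ + b = a + x⁻ := by
    have := posPart_sub_negPart x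
    rw [← sub_eq_sub_iff_add_eq_add, this, hx]
  have h2 := congrArg (rieszSup h) h1
  rw [rieszSup_add h (posPart_nonneg x) hb, rieszSup_add h ha (negPart_nonneg x)] at h2
  linarith

/-- The positive part of a bounded functional: the bounded linear extension to `F` of the
Riesz-Kantorovich supremum on the positive cone. -/
noncomputable def dualPosPart (h : StrongDual ℝ F) : StrongDual ℝ F :=
  LinearMap.mkContinuous
    { toFun := fun x => rieszSup h x⁺ - rieszSup h x⁻
      map_add' := fun x y => by
        rw [rieszSup_posPart_sub h (a := x⁺ + y⁺) (b := x⁻ + y⁻)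
          (add_nonneg (posPart_nonneg x) (posPart_nonneg y))
          (add_nonneg (negPart_nonneg x) (negPart_nonneg y)),
          rieszSup_add h (posPart_nonneg x) (posPart_nonneg y),
          rieszSup_add h (negPart_nonneg x) (negPart_nonneg y)]
        · ring
        · rw [add_sub_add_comm, posPart_sub_negPart, posPart_sub_negPart]
      map_smul' := fun c x => by
        have hp := posPart_nonneg x
        have hn := negPart_nonneg x
        rcases lt_trichotomy c 0 with hc | rfl | hc
        · rw [rieszSup_posPart_sub h (a := (-c) • x⁻) (b := (-c) • x⁺)
            (smul_nonneg (by linarith) hn) (smul_nonneg (by linarith) hp),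
            rieszSup_smul h (by linarith) hn, rieszSup_smul h (by linarith) hp]
          · simp only [RingHom.id_apply, smul_eq_mul]
            ring
          · rw [← smul_sub, ← neg_sub x⁺, posPart_sub_negPart, smul_neg, neg_smul, neg_neg]
        · simp
        · rw [rieszSup_posPart_sub h (a := c • x⁺) (b := c • x⁻)
            (smul_nonneg hc.le hp) (smul_nonneg hc.le hn),
            rieszSup_smul h hc hp, rieszSup_smul h hc hn]
          · simp only [RingHom.id_apply, smul_eq_mul]
            ring
          · rw [← smul_sub, posPart_sub_negPart] }
    ‖h‖ (fun x => by
      have hp := posPart_nonneg x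
      have hn := negPart_nonneg x
      have hle : ∀ y : F, 0 ≤ y → y ≤ |x| → rieszSup h y ≤ ‖h‖ * ‖x‖ := fun y hy hyx =>
        rieszSup_le h hy fun z hz hzy => by
          have := apply_le_norm_mul h hz (hzy.trans hyx)
          rwa [norm_abs_eq_norm] at this
      have h1 := hle x⁺ hp (by rw [← posPart_add_negPart]; exact le_add_of_nonneg_right hn)
      have h2 := hle x⁻ hn (by rw [← posPart_add_negPart]; exact le_add_of_nonneg_left hp)
      have h3 := rieszSup_nonneg h hp
      have h4 := rieszSup_nonneg h hn
      simp only [LinearMap.coe_mk, AddHom.coe_mk, Real.norm_eq_abs]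
      rw [abs_le]
      constructor <;> linarith)

theorem dualPosPart_apply (h : StrongDual ℝ F) {x : F} (hx : 0 ≤ x) :
    dualPosPart h x = sSup (h '' Set.Icc 0 x) := by
  change rieszSup h x⁺ - rieszSup h x⁻ = rieszSup h x
  rw [rieszSup_posPart_sub h hx le_rfl (sub_zero x).symm]
  have : rieszSup h 0 = 0 :=
    le_antisymm (rieszSup_le h le_rfl fun y h0 h1 => by simp [le_antisymm h1 h0])
      (rieszSup_nonneg h le_rfl)
  rw [this, sub_zero]

/-- The canonical order of the dual: `f ≤ g` iff `f x ≤ g x` for all `x ≥ 0`. -/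
instance dualPartialOrder : PartialOrder (StrongDual ℝ F) where
  le f g := ∀ x : F, 0 ≤ x → f x ≤ g x
  le_refl f x hx := le_rfl
  le_trans f g k h₁ h₂ x hx := (h₁ x hx).trans (h₂ x hx)
  le_antisymm f g h₁ h₂ := by
    ext x
    rw [← posPart_sub_negPart x, map_sub, map_sub,
      le_antisymm (h₁ _ (posPart_nonneg x)) (h₂ _ (posPart_nonneg x)),
      le_antisymm (h₁ _ (negPart_nonneg x)) (h₂ _ (negPart_nonneg x))]

theorem dual_le_def (f g : StrongDual ℝ F) : f ≤ g ↔ ∀ x : F, 0 ≤ x → f x ≤ g x := Iff.rfl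

theorem dualPosPart_nonneg (h : StrongDual ℝ F) {x : F} (hx : 0 ≤ x) : 0 ≤ dualPosPart h x := by
  rw [dualPosPart_apply h hx]
  exact rieszSup_nonneg h hx

theorem le_dualPosPart (h : StrongDual ℝ F) {x : F} (hx : 0 ≤ x) : h x ≤ dualPosPart h x := by
  rw [dualPosPart_apply h hx]
  exact le_rieszSup h hx le_rfl

theorem dualPosPart_le {h k : StrongDual ℝ F} (hk : ∀ x : F, 0 ≤ x → 0 ≤ k x)
    (hhk : ∀ x : F, 0 ≤ x → h x ≤ k x) {x : F} (hx : 0 ≤ x) : dualPosPart h x ≤ k x := by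
  rw [dualPosPart_apply h hx]
  refine rieszSup_le h hx fun y hy hyx => (hhk y hy).trans ?_
  have := hk (x - y) (sub_nonneg.2 hyx)
  rw [map_sub] at this
  linarith

/-- The dual of a normed lattice is a lattice; the join of `f` and `g` is `(f - g)⁺ + g`. -/
noncomputable instance dualLattice : Lattice (StrongDual ℝ F) where
  toPartialOrder := dualPartialOrder
  sup f g := dualPosPart (f - g) + g
  inf f g := f - dualPosPart (f - g)
  le_sup_left f g x hx := by
    have := le_dualPosPart (f - g) hx
    simp only [sub_apply, add_apply] at this ⊢
    linarith
  le_sup_right f g x hx := by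
    have := dualPosPart_nonneg (f - g) hx
    simp only [add_apply]
    linarith
  sup_le f g k hf hg x hx := by
    have := dualPosPart_le (h := f - g) (k := k - g)
      (fun y hy => by simpa using hg y hy) (fun y hy => by simpa using hf y hy) hx
    simp only [sub_apply, add_apply] at this ⊢
    linarith
  inf_le_left f g x hx := by
    have := dualPosPart_nonneg (f - g) hx
    simp only [sub_apply]
    linarith
  inf_le_right f g x hx := by
    have := le_dualPosPart (f - g) hx
    simp only [sub_apply] at this ⊢
    linarith
  le_inf k f g hf hg x hx := by
    have := dualPosPart_le (h := f - g) (k := f - k)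
      (fun y hy => by simpa using hf y hy)
      (fun y hy => by have := hg y hy; simp only [sub_apply]; linarith) hx
    simp only [sub_apply] at this ⊢
    linarith

instance dualIsOrderedAddMonoid : IsOrderedAddMonoid (StrongDual ℝ F) where
  add_le_add_left f g hfg k x hx := by
    simpa using hfg x hx

end OrderDual

/-! ### Disjoint sequences, L-weakly compact sets, limited sets -/

/-- A sequence in a vector lattice is disjoint if `|a m| ⊓ |a n| = 0` for all `m ≠ n`. -/
def IsDisjointSeq {E : Type*} [AddCommGroup E] [Lattice E] (a : ℕ → E) : Prop :=
  ∀ m n : ℕ, m ≠ n → |a m| ⊓ |a n| = 0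

/-- `A` is an Lwc-set if each disjoint sequence in the solid hull
`sol(A) = {y | ∃ a ∈ A, |y| ≤ |a|}` of `A` is norm-null. -/
def IsLwcSet {F : Type*} [NormedAddCommGroup F] [Lattice F] (A : Set F) : Prop :=
  ∀ a : ℕ → F, IsDisjointSeq a → (∀ n, a n ∈ LatticeOrderedAddCommGroup.solidClosure A) →
    Tendsto a atTop (𝓝 0)

/-- A sequence of bounded functionals is weak*-null if it converges to `0` in the weak*
topology. -/
def IsWeakStarNull {X : Type*} [NormedAddCommGroup X] [NormedSpace ℝ X]
    (f : ℕ → StrongDual ℝ X) : Prop :=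
  Tendsto (fun n => StrongDual.toWeakDual (f n)) atTop (𝓝 0)

/-- A bounded set `A` is limited if each weak*-null sequence in `X'` is uniformly null on `A`. -/
def IsLimited {X : Type*} [NormedAddCommGroup X] [NormedSpace ℝ X] (A : Set X) : Prop :=
  Bornology.IsBounded A ∧ ∀ f : ℕ → StrongDual ℝ X, IsWeakStarNull f →
    TendstoUniformlyOn (fun n x => f n x) (fun _ => 0) atTop A

/-- A bounded operator is limitedly L-weakly compact if it carries limited sets onto
Lwc-sets. -/
def IsLimitedlyLwc {X F : Type*} [NormedAddCommGroup X] [NormedSpace ℝ X]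
    [NormedAddCommGroup F] [NormedSpace ℝ F] [Lattice F] (T : X →L[ℝ] F) : Prop :=
  ∀ A : Set X, IsLimited A → IsLwcSet (T '' A)

/-- The adjoint `T' : F' → X'`, `T' f = f ∘ T`, of a bounded operator `T : X → F`. -/
def dualOperator {X F : Type*} [NormedAddCommGroup X] [NormedSpace ℝ X]
    [NormedAddCommGroup F] [NormedSpace ℝ F] (T : X →L[ℝ] F) (f : StrongDual ℝ F) :
    StrongDual ℝ X :=
  f.comp T

/-! ### Disjointness in lattice ordered groups -/

section LatticeOrderedGroup

set_option linter.unusedSectionVars false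

variable {G : Type*} [AddCommGroup G] [Lattice G] [IsOrderedAddMonoid G]

/-! Sufficiency: let `y n` be disjoint with `|y n| ≤ |T (a n)|`, `a n ∈ A`. Some `w n` with `0 ≤ w n
≤ |y n|` keeps half the norm of `y n` and lies under the positive or the negative part of `T (a n)`.
A norming functional of `w n`, cut down to the band of `w n`, sees only that part, so its value at
`T (a n)` is at least `‖w n‖` in modulus. These functionals are disjoint and bounded, so their
adjoint images are weak*-null, hence uniformly null on the limited set `A`, and `y n → 0`.

Necessity: a singleton is limited, so disjoint sequences in `[0, |T x|]` are norm-null. If disjoint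
bounded positive functionals stayed away from `0` at `z = |T x|`, `exists_seq_apply_small` would
give elements of `[0, z]` on which some of them stay large while being small on all earlier
elements. `disjoint_truncation` makes these elements disjoint at a small cost, a contradiction. The
moduli `|f n|` reduce the general case to positive functionals. -/

theorem inf_add_eq_zero_of_nonneg {a b c : G} (ha : 0 ≤ a) (hb : 0 ≤ b) (hc : 0 ≤ c)
    (hca : c ⊓ a = 0) (hcb : c ⊓ b = 0) : c ⊓ (a + b) = 0 := by
  refine le_antisymm ?_ (le_inf hc (add_nonneg ha hb))
  have h0 : 0 ≤ c ⊓ (a + b) := le_inf hc (add_nonneg ha hb)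
  have h1 : c ⊓ (a + b) ⊓ a = 0 :=
    le_antisymm (hca ▸ inf_le_inf_right a inf_le_left) (le_inf h0 ha)
  rw [← hcb]
  refine le_inf inf_le_left ?_
  have h2 : c ⊓ (a + b) - b ≤ c ⊓ (a + b) ⊓ a :=
    le_inf (sub_le_self _ hb) (sub_le_iff_le_add.2 inf_le_right)
  rw [h1] at h2
  exact sub_nonpos.1 h2

theorem inf_eq_zero_of_le {a b c d : G} (hc : 0 ≤ c) (hd : 0 ≤ d) (hca : c ≤ a) (hdb : d ≤ b)
    (h : a ⊓ b = 0) : c ⊓ d = 0 :=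
  le_antisymm (h ▸ inf_le_inf hca hdb) (le_inf hc hd)

theorem inf_sum_eq_zero {ι : Type*} {s : Finset ι} {h : ι → G} {c : G} (hc : 0 ≤ c)
    (hh : ∀ i ∈ s, 0 ≤ h i) (hd : ∀ i ∈ s, c ⊓ h i = 0) : c ⊓ ∑ i ∈ s, h i = 0 := by
  classical
  induction s using Finset.induction_on with
  | empty => simpa using hc
  | insert a s ha ih =>
    rw [Finset.sum_insert ha]
    simp only [Finset.mem_insert, forall_eq_or_imp] at hh hd
    exact inf_add_eq_zero_of_nonneg hh.1 (Finset.sum_nonneg hh.2) hc hd.1 (ih hh.2 hd.2)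

/-- For disjoint positive elements the sum is the supremum, because `a + b = a ⊓ b + a ⊔ b`. -/
theorem sum_le_of_pairwise_inf_eq_zero {ι : Type*} (s : Finset ι) {h : ι → G} {g : G}
    (hg : 0 ≤ g) (hh : ∀ i, 0 ≤ h i) (hd : ∀ i j, i ≠ j → h i ⊓ h j = 0) (hhg : ∀ i, h i ≤ g) :
    ∑ i ∈ s, h i ≤ g := by
  classical
  induction s using Finset.induction_on with
  | empty => simpa using hg
  | insert a s ha ih =>
    rw [Finset.sum_insert ha]
    have h1 : h a ⊓ ∑ i ∈ s, h i = 0 :=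
      inf_sum_eq_zero (hh a) (fun i _ => hh i) fun i hi => hd a i fun h => ha (h ▸ hi)
    have h2 := inf_add_sup (h a) (∑ i ∈ s, h i)
    rw [h1, zero_add] at h2
    rw [← h2]
    exact sup_le (hhg a) ih

end LatticeOrderedGroup

section NormedLattice

set_option linter.unusedSectionVars false

variable {F : Type*} [NormedAddCommGroup F] [NormedSpace ℝ F] [Lattice F] [HasSolidNorm F]
  [IsOrderedAddMonoid F] [IsOrderedModule ℝ F]

/-- An element dominated in modulus by `z` has a minorant of at least half its norm below `z⁺` or
below `z⁻`. -/
theorem exists_le_posPart_or_le_negPart {y z : F} (hyz : |y| ≤ |z|) :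
    ∃ w : F, 0 ≤ w ∧ w ≤ |y| ∧ ‖y‖ ≤ 2 * ‖w‖ ∧ (w ≤ z⁺ ∨ w ≤ z⁻) := by
  have hp := posPart_nonneg z
  have hn := negPart_nonneg z
  have hp' : 0 ≤ |y| ⊓ z⁺ := le_inf (abs_nonneg y) hp
  have hn' : 0 ≤ |y| ⊓ z⁻ := le_inf (abs_nonneg y) hn
  have h1 : |y| ≤ |y| ⊓ z⁺ + |y| ⊓ z⁻ := by
    have h2 : |y| - |y| ⊓ z⁺ ≤ |y| ⊓ z⁻ := by
      refine le_inf (sub_le_self _ hp') ?_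
      rw [sub_le_comm]
      refine le_inf (sub_le_self _ hn) (sub_le_iff_le_add.2 ?_)
      rwa [posPart_add_negPart]
    exact sub_le_iff_le_add'.1 h2
  have h3 : ‖y‖ ≤ ‖|y| ⊓ z⁺‖ + ‖|y| ⊓ z⁻‖ := by
    refine le_trans (norm_le_norm_of_abs_le_abs ?_) (norm_add_le _ _)
    rwa [abs_of_nonneg (add_nonneg hp' hn')]
  rcases le_total ‖|y| ⊓ z⁺‖ ‖|y| ⊓ z⁻‖ with h | h
  · exact ⟨_, hn', inf_le_left, by linarith, Or.inr inf_le_right⟩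
  · exact ⟨_, hp', inf_le_left, by linarith, Or.inl inf_le_right⟩

/-! ### Functionals carried by a band -/

/-- The positive cone of the band generated by `w`: the positive elements that are disjoint from
every positive element disjoint from `w`. -/
def bandCone (w : F) : Set F := {y | 0 ≤ y ∧ ∀ v, 0 ≤ v → v ⊓ w = 0 → v ⊓ y = 0}

theorem mem_bandCone_self {w : F} (hw : 0 ≤ w) : w ∈ bandCone w := ⟨hw, fun _ _ h => h⟩

theorem zero_mem_bandCone (w : F) : (0 : F) ∈ bandCone w := ⟨le_rfl, fun _ hv _ => inf_eq_right.2 hv⟩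

theorem add_mem_bandCone {w x y : F} (hx : x ∈ bandCone w) (hy : y ∈ bandCone w) :
    x + y ∈ bandCone w :=
  ⟨add_nonneg hx.1 hy.1, fun v hv hvw =>
    inf_add_eq_zero_of_nonneg hx.1 hy.1 hv (hx.2 v hv hvw) (hy.2 v hv hvw)⟩

theorem mem_bandCone_of_le {w x y : F} (hx : 0 ≤ x) (hxy : x ≤ y) (hy : y ∈ bandCone w) :
    x ∈ bandCone w :=
  ⟨hx, fun v hv hvw => inf_eq_zero_of_le hv hx le_rfl hxy (hy.2 v hv hvw)⟩

/-- The Riesz-Kantorovich supremum of `h` over the part of `[0, x]` in the band of `w`. -/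
noncomputable def bandSup (h : StrongDual ℝ F) (w x : F) : ℝ :=
  sSup (h '' (Set.Icc 0 x ∩ bandCone w))

theorem le_bandSup (h : StrongDual ℝ F) {w x y : F} (hy : y ∈ bandCone w) (hyx : y ≤ x) :
    h y ≤ bandSup h w x := by
  refine le_csSup ⟨‖h‖ * ‖x‖, ?_⟩ ⟨y, ⟨⟨hy.1, hyx⟩, hy⟩, rfl⟩
  rintro _ ⟨z, hz, rfl⟩
  exact apply_le_norm_mul h hz.1.1 hz.1.2

theorem image_bandSup_nonempty (h : StrongDual ℝ F) (w : F) {x : F} (hx : 0 ≤ x) :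
    (h '' (Set.Icc 0 x ∩ bandCone w)).Nonempty :=
  ⟨h 0, 0, ⟨⟨le_rfl, hx⟩, zero_mem_bandCone w⟩, rfl⟩

theorem bandSup_le (h : StrongDual ℝ F) {w x : F} (hx : 0 ≤ x) {c : ℝ}
    (hc : ∀ y ∈ bandCone w, y ≤ x → h y ≤ c) : bandSup h w x ≤ c := by
  refine csSup_le (image_bandSup_nonempty h w hx) ?_
  rintro _ ⟨z, hz, rfl⟩
  exact hc z hz.2 hz.1.2

theorem bandSup_nonneg (h : StrongDual ℝ F) (w : F) {x : F} (hx : 0 ≤ x) : 0 ≤ bandSup h w x := by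
  simpa using le_bandSup h (zero_mem_bandCone w) hx

theorem bandSup_le_norm_mul (h : StrongDual ℝ F) (w : F) {x : F} (hx : 0 ≤ x) :
    bandSup h w x ≤ ‖h‖ * ‖x‖ :=
  bandSup_le h hx fun _ hy hyx => apply_le_norm_mul h hy.1 hyx

theorem bandSup_add (h : StrongDual ℝ F) (w : F) {x y : F} (hx : 0 ≤ x) (hy : 0 ≤ y) :
    bandSup h w (x + y) = bandSup h w x + bandSup h w y := by
  apply le_antisymm
  · refine bandSup_le h (add_nonneg hx hy) fun z hz hzxy => ?_
    have h0 : 0 ≤ z ⊓ x := le_inf hz.1 hx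
    have h1 : h (z ⊓ x) ≤ bandSup h w x :=
      le_bandSup h (mem_bandCone_of_le h0 inf_le_left hz) inf_le_right
    have h2 : h (z - z ⊓ x) ≤ bandSup h w y := by
      refine le_bandSup h
        (mem_bandCone_of_le (sub_nonneg.2 inf_le_left) (sub_le_self _ h0) hz) ?_
      rw [sub_le_comm]
      exact le_inf (sub_le_self z hy) (sub_le_iff_le_add.2 hzxy)
    rw [map_sub] at h2
    linarith
  · rw [← le_sub_iff_add_le]
    refine bandSup_le h hx fun u hu hux => ?_
    rw [le_sub_comm]
    refine bandSup_le h hy fun v hv hvy => ?_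
    rw [le_sub_iff_add_le, add_comm, ← map_add]
    exact le_bandSup h (add_mem_bandCone hu hv) (add_le_add hux hvy)

theorem bandSup_posPart_sub (h : StrongDual ℝ F) (w : F) {x a b : F} (ha : 0 ≤ a) (hb : 0 ≤ b)
    (hx : x = a - b) : bandSup h w x⁺ - bandSup h w x⁻ = bandSup h w a - bandSup h w b := by
  have h1 : x⁺ + b = a + x⁻ := by
    have := posPart_sub_negPart x
    rw [← sub_eq_sub_iff_add_eq_add, this, hx]
  have h2 := congrArg (bandSup h w) h1
  rw [bandSup_add h w (posPart_nonneg x) hb, bandSup_add h w ha (negPart_nonneg x)] at h2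
  linarith

/-- The additive extension of `bandSup h w` to all of `F`. -/
noncomputable def bandAddHom (h : StrongDual ℝ F) (w : F) : F →+ ℝ :=
  AddMonoidHom.mk' (fun x => bandSup h w x⁺ - bandSup h w x⁻) fun x y => by
    rw [bandSup_posPart_sub h w (a := x⁺ + y⁺) (b := x⁻ + y⁻)
      (add_nonneg (posPart_nonneg x) (posPart_nonneg y))
      (add_nonneg (negPart_nonneg x) (negPart_nonneg y)),
      bandSup_add h w (posPart_nonneg x) (posPart_nonneg y),
      bandSup_add h w (negPart_nonneg x) (negPart_nonneg y)]
    · ring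
    · rw [add_sub_add_comm, posPart_sub_negPart, posPart_sub_negPart]

theorem norm_bandAddHom_le (h : StrongDual ℝ F) (w x : F) :
    ‖bandAddHom h w x‖ ≤ ‖h‖ * ‖x‖ := by
  have hp := posPart_nonneg x
  have hn := negPart_nonneg x
  have hle : ∀ y : F, 0 ≤ y → y ≤ |x| → bandSup h w y ≤ ‖h‖ * ‖x‖ := fun y hy hyx =>
    bandSup_le h hy fun z hz hzy => by
      have := apply_le_norm_mul h hz.1 (hzy.trans hyx)
      rwa [norm_abs_eq_norm] at this
  have h1 := hle x⁺ hp (by rw [← posPart_add_negPart]; exact le_add_of_nonneg_right hn)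
  have h2 := hle x⁻ hn (by rw [← posPart_add_negPart]; exact le_add_of_nonneg_left hp)
  have h3 := bandSup_nonneg h w hp
  have h4 := bandSup_nonneg h w hn
  change |bandSup h w x⁺ - bandSup h w x⁻| ≤ _
  rw [abs_le]
  constructor <;> linarith

/-- The part of the positive part of `h` that is carried by the band of `w`. -/
noncomputable def bandDual (h : StrongDual ℝ F) (w : F) : StrongDual ℝ F :=
  -- A continuous additive map is real linear, so homogeneity needs no separate proof.
  (bandAddHom h w).toRealLinearMap
    (AddMonoidHomClass.continuous_of_bound (bandAddHom h w) ‖h‖ (norm_bandAddHom_le h w))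

theorem bandDual_apply (h : StrongDual ℝ F) (w : F) {x : F} (hx : 0 ≤ x) :
    bandDual h w x = bandSup h w x := by
  change bandSup h w x⁺ - bandSup h w x⁻ = _
  rw [bandSup_posPart_sub h w hx le_rfl (sub_zero x).symm]
  have : bandSup h w 0 = 0 :=
    le_antisymm (by simpa using bandSup_le_norm_mul h w (le_refl (0 : F)))
      (bandSup_nonneg h w le_rfl)
  rw [this, sub_zero]

theorem norm_bandDual_le (h : StrongDual ℝ F) (w : F) : ‖bandDual h w‖ ≤ ‖h‖ :=
  ContinuousLinearMap.opNorm_le_bound _ (norm_nonneg h) (norm_bandAddHom_le h w)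

theorem bandDual_nonneg (h : StrongDual ℝ F) (w : F) : 0 ≤ bandDual h w := fun x hx => by
  rw [bandDual_apply h w hx]
  exact bandSup_nonneg h w hx

theorem bandDual_apply_eq_zero (h : StrongDual ℝ F) {w x : F} (hx : 0 ≤ x) (hxw : x ⊓ w = 0) :
    bandDual h w x = 0 := by
  refine le_antisymm ?_ (by simpa using bandDual_nonneg h w x hx)
  rw [bandDual_apply h w hx]
  refine bandSup_le h hx fun y hy hyx => ?_
  have h1 := hy.2 x hx hxw
  rw [inf_eq_right.2 hyx] at h1
  simp [h1]

theorem bandDual_inf_bandDual (h k : StrongDual ℝ F) {v w : F} (hw : 0 ≤ w)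
    (hvw : v ⊓ w = 0) : bandDual h v ⊓ bandDual k w = 0 := by
  refine le_antisymm (fun x hx => ?_) (le_inf (bandDual_nonneg h v) (bandDual_nonneg k w))
  refine le_of_forall_pos_le_add fun e he => ?_
  -- Split `x = (x - y) + y` with `y` nearly optimal in the band of `v`: the first functional is
  -- below `e` at `x - y`, and the second vanishes at `y`, which is disjoint from `w`.
  obtain ⟨_, ⟨y, ⟨⟨hy0, hyx⟩, hy⟩, rfl⟩, hye⟩ := exists_lt_of_lt_csSup
    (image_bandSup_nonempty h v hx) (sub_lt_self (bandSup h v x) he)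
  have h1 : (bandDual h v ⊓ bandDual k w) (x - y) ≤ bandDual h v (x - y) :=
    (inf_le_left : bandDual h v ⊓ bandDual k w ≤ _) _ (sub_nonneg.2 hyx)
  have h2 : (bandDual h v ⊓ bandDual k w) y ≤ bandDual k w y :=
    (inf_le_right : bandDual h v ⊓ bandDual k w ≤ _) _ hy0
  rw [bandDual_apply_eq_zero k hy0
    (by rw [inf_comm]; exact hy.2 w hw (by rw [inf_comm]; exact hvw))] at h2
  have h3 := le_bandSup h hy le_rfl
  rw [← bandDual_apply h v hy0] at h3
  rw [← bandDual_apply h v hx] at hye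
  rw [map_sub, map_sub] at h1
  simp only [zero_apply]
  linarith

/-- If every disjoint norm bounded sequence of functionals is null along `z`, then every disjoint
sequence dominated by `z` is norm null. -/
theorem tendsto_zero_of_forall_disjoint_dual {y z : ℕ → F} (hy : IsDisjointSeq y)
    (hyz : ∀ n, |y n| ≤ |z n|)
    (hz : ∀ g : ℕ → StrongDual ℝ F, IsDisjointSeq g → Bornology.IsBounded (Set.range g) →
      Tendsto (fun n => g n (z n)) atTop (𝓝 0)) :
    Tendsto y atTop (𝓝 0) := by
  choose w hw0 hwy hyw hwz using fun n => exists_le_posPart_or_le_negPart (hyz n)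
  choose h hh hhw using fun n => exists_dual_vector'' ℝ (w n)
  have hdis : ∀ m n, m ≠ n → bandDual (h m) (w m) ⊓ bandDual (h n) (w n) = 0 := fun m n hmn =>
    bandDual_inf_bandDual _ _ (hw0 n)
      (inf_eq_zero_of_le (hw0 m) (hw0 n) (hwy m) (hwy n) (hy m n hmn))
  have hlim := hz (fun n => bandDual (h n) (w n))
    (fun m n hmn => by
      rw [abs_of_nonneg (bandDual_nonneg _ _), abs_of_nonneg (bandDual_nonneg _ _)]
      exact hdis m n hmn)
    (isBounded_iff_forall_norm_le.2 ⟨1, by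
      rintro _ ⟨n, rfl⟩
      exact (norm_bandDual_le _ _).trans (hh n)⟩)
  refine squeeze_zero_norm (fun n => ?_) (by simpa using hlim.abs.const_mul 2)
  refine (hyw n).trans (mul_le_mul_of_nonneg_left ?_ zero_le_two)
  have hmono : ∀ x, w n ≤ x → ‖w n‖ ≤ bandDual (h n) (w n) x := fun x hx => by
    rw [bandDual_apply _ _ ((hw0 n).trans hx)]
    have := le_bandSup (h n) (mem_bandCone_self (hw0 n)) hx
    rw [hhw n] at this
    simpa using this
  have hpn : (z n)⁺ ⊓ (z n)⁻ = 0 := posPart_inf_negPart_eq_zero _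
  have hsub : bandDual (h n) (w n) (z n) =
      bandDual (h n) (w n) (z n)⁺ - bandDual (h n) (w n) (z n)⁻ := by
    rw [← map_sub, posPart_sub_negPart]
  -- The part of `z n` not above `w n` is disjoint from `w n`, so it contributes nothing and no
  -- cancellation occurs.
  rcases hwz n with hle | hle
  · have h0 := bandDual_apply_eq_zero (h n) (negPart_nonneg (z n))
      (inf_eq_zero_of_le (negPart_nonneg (z n)) (hw0 n) le_rfl hle (by rwa [inf_comm]))
    rw [hsub, h0, sub_zero]
    exact (hmono _ hle).trans (le_abs_self _)
  · have h0 := bandDual_apply_eq_zero (h n) (posPart_nonneg (z n))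
      (inf_eq_zero_of_le (posPart_nonneg (z n)) (hw0 n) le_rfl hle hpn)
    rw [hsub, h0, zero_sub, abs_neg]
    exact (hmono _ hle).trans (le_abs_self _)

/-! ### Disjoint functionals on an L-weakly compact order interval -/

/-- Banach-Alaoglu; an ultrafilter is used because bounded sequences in `F'` need not have
weak*-convergent subsequences. -/
theorem exists_weakStar_limit (U : Ultrafilter ℕ) {f : ℕ → StrongDual ℝ F} {M : ℝ}
    (hM : ∀ n, ‖f n‖ ≤ M) : ∃ g : StrongDual ℝ F, ∀ x, Tendsto (fun n => f n x) U (𝓝 (g x)) := by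
  obtain ⟨g, -, hg⟩ := (WeakDual.isCompact_closedBall (𝕜 := ℝ) (0 : StrongDual ℝ F)
    M).ultrafilter_le_nhds (U.map fun n => StrongDual.toWeakDual (f n)) (by
      rw [le_principal_iff]
      exact Filter.mem_map.2 (Filter.univ_mem' fun n => by simpa using hM n))
  refine ⟨WeakDual.toStrongDual g, fun x => ?_⟩
  exact ((WeakDual.eval_continuous x).tendsto g).comp hg

/-- Riesz-Kantorovich formula: `(f ⊓ g) z` is the infimum of `f (z - y) + g y` over `0 ≤ y ≤ z`. -/
theorem exists_apply_lt_of_inf_apply_lt (f g : StrongDual ℝ F) {z : F} (hz : 0 ≤ z) {e : ℝ}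
    (h : (f ⊓ g) z < e) : ∃ y, 0 ≤ y ∧ y ≤ z ∧ f (z - y) + g y < e := by
  change (f - dualPosPart (f - g)) z < e at h
  rw [sub_apply, dualPosPart_apply _ hz, sub_lt_comm] at h
  obtain ⟨_, ⟨y, hy, rfl⟩, hye⟩ :=
    exists_lt_of_lt_csSup ((Set.nonempty_Icc.2 hz).image (f - g)) h
  refine ⟨y, hy.1, hy.2, ?_⟩
  rw [sub_apply] at hye
  rw [map_sub]
  linarith

/-- The `f n ⊓ g` are disjoint and below `g`, so their values at `z` form a series with partial sums
at most `g z`. -/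
theorem tendsto_inf_apply_of_disjoint {f : ℕ → StrongDual ℝ F} {g : StrongDual ℝ F}
    (hf : ∀ n, 0 ≤ f n) (hg : 0 ≤ g) (hd : ∀ m n, m ≠ n → f m ⊓ f n = 0) {z : F} (hz : 0 ≤ z) :
    Tendsto (fun n => (f n ⊓ g) z) atTop (𝓝 0) := by
  have h0 : ∀ n, 0 ≤ f n ⊓ g := fun n => le_inf (hf n) hg
  refine (summable_of_sum_le (c := g z) (fun n => by simpa using h0 n z hz)
    fun s => ?_).tendsto_atTop_zero
  have := sum_le_of_pairwise_inf_eq_zero s hg h0 (fun i j hij =>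
    inf_eq_zero_of_le (h0 i) (h0 j) inf_le_left inf_le_left (hd i j hij))
    (fun i => inf_le_right) z hz
  simpa using this

/-- Given disjoint positive functionals that are bounded below at `z`, there are elements of
`[0, z]` on which a subfamily stays bounded below, while being small on the preceding elements. -/
theorem exists_seq_apply_small {f : ℕ → StrongDual ℝ F} (hf : ∀ n, 0 ≤ f n)
    (hd : ∀ m n, m ≠ n → f m ⊓ f n = 0) {M : ℝ} (hM : ∀ n, ‖f n‖ ≤ M) {z : F} (hz : 0 ≤ z)
    {e : ℝ} (he : 0 < e) (hfz : ∀ n, e ≤ f n z) {r : ℝ} (hr : 0 < r) :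
    ∃ (i : ℕ → ℕ) (x : ℕ → F), (∀ n, 0 ≤ x n) ∧ (∀ n, x n ≤ z) ∧ (∀ n, e / 2 ≤ f (i n) (x n)) ∧
      ∀ m n, m < n → f (i n) (x m) ≤ r * (1 / 2) ^ m := by
  -- If `g` is small at an element, then `f n` is small there for ultrafilter-many `n`; this allows
  -- finitely many earlier elements to be handled at once.
  obtain ⟨g, hg⟩ := exists_weakStar_limit (hyperfilter ℕ) hM
  have hg0 : 0 ≤ g := fun x hx => by
    simpa using ge_of_tendsto' (hg x) fun n => hf n x hx
  have hinf := (tendsto_inf_apply_of_disjoint hf hg0 hd hz).mono_left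
    (Nat.hyperfilter_le_atTop)
  obtain ⟨u, huP, hur⟩ := exists_seq_of_forall_finset_exists
    (α := ℕ × F × ℕ)
    (fun p => 0 ≤ p.2.1 ∧ p.2.1 ≤ z ∧ e / 2 ≤ f p.1 p.2.1 ∧ g p.2.1 < r * (1 / 2) ^ p.2.2)
    (fun p q => p.2.2 < q.2.2 ∧ f q.1 p.2.1 < r * (1 / 2) ^ p.2.2) (fun s hs => by
      have h1 : ∀ᶠ n in (hyperfilter ℕ : Filter ℕ), ∀ p ∈ s, f n p.2.1 < r * (1 / 2) ^ p.2.2 :=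
        (Filter.eventually_all_finset s).2 fun p hp =>
          (hg p.2.1).eventually_lt_const (hs p hp).2.2.2
      -- The exponent exceeds all earlier ones, so the `m`-th exponent is at least `m`.
      set K := s.sup (fun p => p.2.2) + 1 with hK
      have hpos : 0 < min (e / 2) (r * (1 / 2) ^ K) := lt_min (by positivity) (by positivity)
      obtain ⟨n, hn1, hn2⟩ := (h1.and (hinf.eventually_lt_const hpos)).exists
      obtain ⟨y, hy0, hyz, hy⟩ := exists_apply_lt_of_inf_apply_lt _ _ hz hn2
      obtain ⟨hy1, hy2⟩ := lt_min_iff.1 hy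
      have h3 : 0 ≤ g y := by simpa using hg0 y hy0
      have h4 : 0 ≤ f n (z - y) := by simpa using hf n (z - y) (sub_nonneg.2 hyz)
      have h5 := hfz n
      have h6 : f n (z - y) = f n z - f n y := map_sub _ _ _
      refine ⟨(n, y, K), ⟨hy0, hyz, by simp only; linarith, by simp only; linarith⟩,
        fun p hp => ⟨?_, hn1 p hp⟩⟩
      exact Nat.lt_succ_of_le (Finset.le_sup (f := fun p : ℕ × F × ℕ => p.2.2) hp))
  refine ⟨fun n => (u n).1, fun n => (u n).2.1, fun n => (huP n).1, fun n => (huP n).2.1,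
    fun n => (huP n).2.2.1, fun m n hmn => (hur m n hmn).2.le.trans ?_⟩
  have hmono : StrictMono fun n => (u n).2.2 := fun a b hab => (hur a b hab).1
  exact mul_le_mul_of_nonneg_left
    (pow_le_pow_of_le_one (by norm_num) (by norm_num) (hmono.le_apply)) hr.le

/-- Truncation of a sequence in `[0, z]` to a disjoint sequence. -/
theorem disjoint_truncation {x : ℕ → F} {z : F} {d : ℝ} (hd : 0 < d) (hd1 : d ≤ 1) (hz : 0 ≤ z)
    (hx : ∀ n, 0 ≤ x n) (hxz : ∀ n, x n ≤ z) {m n : ℕ} (hmn : m < n) :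
    (x m - d • z - d⁻¹ • ∑ i ∈ Finset.range m, x i)⁺ ⊓
      (x n - d • z - d⁻¹ • ∑ i ∈ Finset.range n, x i)⁺ = 0 := by
  have hdi : 0 ≤ d⁻¹ := (inv_pos.2 hd).le
  -- The two truncations lie below the positive and the negative part of `d⁻¹ • x m - z`; the second
  -- because `x m` occurs in its subtracted sum.
  refine inf_eq_zero_of_le (posPart_nonneg _) (posPart_nonneg _) ?_ ?_
    (posPart_inf_negPart_eq_zero (d⁻¹ • x m - z))
  · refine sup_le ?_ (posPart_nonneg _)
    have h1 : x m - d • z - d⁻¹ • ∑ i ∈ Finset.range m, x i ≤ d • (d⁻¹ • x m - z) := by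
      rw [smul_sub, smul_inv_smul₀ hd.ne']
      exact sub_le_self _ (smul_nonneg hdi (Finset.sum_nonneg fun i _ => hx i))
    refine h1.trans ((smul_le_smul_of_nonneg_left (le_posPart _) hd.le).trans ?_)
    simpa using smul_le_smul_of_nonneg_right hd1 (posPart_nonneg (d⁻¹ • x m - z))
  · refine sup_le ?_ (negPart_nonneg _)
    refine le_trans ?_ (neg_le_negPart _)
    rw [neg_sub]
    have h2 : x m ≤ ∑ i ∈ Finset.range n, x i :=
      Finset.single_le_sum (fun i _ => hx i) (Finset.mem_range.2 hmn)
    exact sub_le_sub ((sub_le_self _ (smul_nonneg hd.le hz)).trans (hxz n))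
      (smul_le_smul_of_nonneg_left h2 hdi)

theorem tendsto_apply_of_disjoint_nonneg {z : F} (hz : 0 ≤ z)
    (hL : ∀ v : ℕ → F, (∀ n, 0 ≤ v n) → (∀ n, v n ≤ z) → IsDisjointSeq v →
      Tendsto v atTop (𝓝 0))
    {f : ℕ → StrongDual ℝ F} (hf : ∀ n, 0 ≤ f n) (hd : ∀ m n, m ≠ n → f m ⊓ f n = 0) {M : ℝ}
    (hM : ∀ n, ‖f n‖ ≤ M) : Tendsto (fun n => f n z) atTop (𝓝 0) := by
  by_contra hcon
  obtain ⟨e, he, hfreq⟩ : ∃ e > 0, ∃ᶠ n in atTop, e ≤ f n z := by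
    rw [Metric.tendsto_atTop] at hcon
    push Not at hcon
    obtain ⟨e, he, h⟩ := hcon
    refine ⟨e, he, Filter.frequently_atTop.2 fun N => ?_⟩
    obtain ⟨n, hn, hne⟩ := h N
    refine ⟨n, hn, ?_⟩
    rwa [Real.dist_0_eq_abs, abs_of_nonneg (by simpa using hf n z hz)] at hne
  obtain ⟨φ, hφ, hφe⟩ := Filter.extraction_of_frequently_atTop hfreq
  have hM0 : 0 ≤ M := (norm_nonneg _).trans (hM 0)
  set B := M * ‖z‖ + 1 with hB
  have hB0 : 0 < B := by positivity
  have hzB : ∀ n, f n z ≤ B := fun n => by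
    have h1 := apply_le_norm_mul (f n) hz le_rfl
    have h2 := mul_le_mul_of_nonneg_right (hM n) (norm_nonneg z)
    linarith
  -- Subtracting `d • z` costs at most `e / 8`; with `r = d * (e / 16)`, so does the sum scaled by
  -- `d⁻¹`. Of `e / 2` there remains `e / 4`.
  set d := min 1 (e / (8 * B)) with hdd
  have hd0 : 0 < d := lt_min one_pos (by positivity)
  have hdB : d * B ≤ e / 8 := by
    calc d * B ≤ e / (8 * B) * B := mul_le_mul_of_nonneg_right (min_le_right _ _) hB0.le
      _ = e / 8 := by field_simp
  obtain ⟨i, x, hx0, hxz, hxe, hxs⟩ := exists_seq_apply_small (f := fun n => f (φ n))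
    (fun n => hf _) (fun m n hmn => hd _ _ (hφ.injective.ne hmn)) (fun n => hM _) hz he hφe
    (r := d * (e / 16)) (by positivity)
  set v : ℕ → F := fun n => (x n - d • z - d⁻¹ • ∑ j ∈ Finset.range n, x j)⁺ with hv
  have hv0 : ∀ n, 0 ≤ v n := fun n => posPart_nonneg _
  have hdis : ∀ m n, m < n → v m ⊓ v n = 0 := fun m n hmn =>
    disjoint_truncation hd0 (min_le_left _ _) hz hx0 hxz hmn
  have hlim := hL v hv0
    (fun n => sup_le (((sub_le_self _ (smul_nonneg (inv_pos.2 hd0).le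
      (Finset.sum_nonneg fun j _ => hx0 j))).trans
      (sub_le_self _ (smul_nonneg hd0.le hz))).trans (hxz n)) hz)
    (fun m n hmn => by
      rw [abs_of_nonneg (hv0 m), abs_of_nonneg (hv0 n)]
      rcases hmn.lt_or_gt with h | h
      · exact hdis m n h
      · rw [inf_comm]; exact hdis n m h)
  have hlow : ∀ n, e / 4 ≤ M * ‖v n‖ := fun n => by
    have h1 : f (φ (i n)) (x n - d • z - d⁻¹ • ∑ j ∈ Finset.range n, x j) ≤ f (φ (i n)) (v n) := by
      have := hf (φ (i n)) _ (sub_nonneg.2 (le_posPart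
        (x n - d • z - d⁻¹ • ∑ j ∈ Finset.range n, x j)))
      rw [map_sub] at this
      simpa using this
    have h2 := apply_le_norm_mul (f (φ (i n))) (hv0 n) le_rfl
    have h3 := mul_le_mul_of_nonneg_right (hM (φ (i n))) (norm_nonneg (v n))
    have h4 : ∑ j ∈ Finset.range n, f (φ (i n)) (x j) ≤ d * (e / 16) * 2 := by
      calc ∑ j ∈ Finset.range n, f (φ (i n)) (x j)
          ≤ ∑ j ∈ Finset.range n, d * (e / 16) * (1 / 2) ^ j :=
            Finset.sum_le_sum fun j hj => hxs j n (Finset.mem_range.1 hj)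
        _ = d * (e / 16) * ∑ j ∈ Finset.range n, (1 / 2) ^ j := by rw [Finset.mul_sum]
        _ ≤ d * (e / 16) * 2 :=
            mul_le_mul_of_nonneg_left (sum_geometric_two_le n) (by positivity)
    have h5 : d⁻¹ * ∑ j ∈ Finset.range n, f (φ (i n)) (x j) ≤ e / 8 := by
      calc _ ≤ d⁻¹ * (d * (e / 16) * 2) :=
            mul_le_mul_of_nonneg_left h4 (inv_pos.2 hd0).le
        _ = e / 8 := by field_simp; ring
    have h6 : d * f (φ (i n)) z ≤ e / 8 :=
      (mul_le_mul_of_nonneg_left (hzB _) hd0.le).trans hdB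
    rw [map_sub, map_sub, map_smul, map_smul, map_sum, smul_eq_mul, smul_eq_mul] at h1
    have h7 := hxe n
    linarith
  have h0 : Tendsto (fun n => M * ‖v n‖) atTop (𝓝 0) := by simpa using hlim.norm.const_mul M
  have := ge_of_tendsto' h0 hlow
  linarith

/-! ### The modulus of a functional -/

theorem norm_dual_abs_le (f : StrongDual ℝ F) : ‖|f|‖ ≤ 3 * ‖f‖ := by
  -- By the definition of the join, `|f| = (2f)⁺ - f`, whence the crude constant `3`.
  change ‖dualPosPart (f - -f) + -f‖ ≤ _
  have h1 : ‖dualPosPart (f - -f)‖ ≤ ‖f - -f‖ := LinearMap.mkContinuous_norm_le _ (norm_nonneg _) _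
  have h2 : ‖f - -f‖ ≤ ‖f‖ + ‖-f‖ := norm_sub_le _ _
  have h3 := norm_add_le (dualPosPart (f - -f)) (-f)
  rw [norm_neg] at h2 h3
  linarith

theorem abs_apply_le_dual_abs (f : StrongDual ℝ F) (x : F) : |f x| ≤ |f| |x| := by
  have h : ∀ y : F, 0 ≤ y → |f y| ≤ |f| y := fun y hy => abs_le'.2
    ⟨(le_abs_self f) y hy, by simpa using (neg_le_abs f) y hy⟩
  have hp := h x⁺ (posPart_nonneg x)
  have hn := h x⁻ (negPart_nonneg x)
  rw [← posPart_add_negPart x, map_add]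
  conv_lhs => rw [← posPart_sub_negPart x, map_sub]
  exact (abs_sub _ _).trans (add_le_add hp hn)

end NormedLattice

/-! ### Weak*-null sequences, limited sets and the equivalence -/

theorem isWeakStarNull_iff {X : Type*} [NormedAddCommGroup X] [NormedSpace ℝ X]
    {f : ℕ → StrongDual ℝ X} :
    IsWeakStarNull f ↔ ∀ x, Tendsto (fun n => f n x) atTop (𝓝 0) :=
  tendsto_iff_forall_eval_tendsto_topDualPairing

theorem isLimited_singleton {X : Type*} [NormedAddCommGroup X] [NormedSpace ℝ X] (x : X) :
    IsLimited {x} :=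
  ⟨Bornology.isBounded_singleton, fun f hf => by
    rw [tendstoUniformlyOn_singleton_iff_tendsto]
    exact isWeakStarNull_iff.1 hf x⟩

theorem IsLimited.tendsto_apply {X : Type*} [NormedAddCommGroup X] [NormedSpace ℝ X] {A : Set X}
    (hA : IsLimited A) {f : ℕ → StrongDual ℝ X} (hf : IsWeakStarNull f) {a : ℕ → X}
    (ha : ∀ n, a n ∈ A) : Tendsto (fun n => f n (a n)) atTop (𝓝 0) := by
  rw [Metric.tendsto_nhds]
  intro e he
  filter_upwards [Metric.tendstoUniformlyOn_iff.1 (hA.2 f hf) e he] with n hn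
  rw [dist_comm]
  exact hn (a n) (ha n)

theorem mainTheorem1 {X F : Type*} [NormedAddCommGroup X] [NormedSpace ℝ X] [CompleteSpace X]
    [NormedAddCommGroup F] [NormedSpace ℝ F] [CompleteSpace F]
    [Lattice F] [IsOrderedAddMonoid F] [IsOrderedModule ℝ F] [HasSolidNorm F]
    (T : X →L[ℝ] F) :
    IsLimitedlyLwc T ↔
      ∀ f : ℕ → StrongDual ℝ F, IsDisjointSeq f → Bornology.IsBounded (Set.range f) →
        IsWeakStarNull (fun n => dualOperator T (f n)) := by
  constructor
  · intro hT f hf hb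
    refine isWeakStarNull_iff.2 fun x => ?_
    obtain ⟨C, hC⟩ := isBounded_iff_forall_norm_le.1 hb
    refine squeeze_zero_norm (fun n => abs_apply_le_dual_abs (f n) (T x)) ?_
    refine tendsto_apply_of_disjoint_nonneg (abs_nonneg (T x)) (fun v hv0 hv hvd => ?_)
      (fun n => abs_nonneg (f n)) hf (M := 3 * C) fun n => (norm_dual_abs_le (f n)).trans ?_
    · refine hT {x} (isLimited_singleton x) v hvd fun n => ⟨T x, ⟨x, rfl, rfl⟩, ?_⟩
      rw [abs_of_nonneg (hv0 n)]
      exact hv n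
    · exact mul_le_mul_of_nonneg_left (hC _ ⟨n, rfl⟩) (by norm_num)
  · intro h A hA y hy hyA
    choose b hb hyb using hyA
    choose a ha hab using hb
    refine tendsto_zero_of_forall_disjoint_dual hy hyb fun g hg hgb => ?_
    simpa [dualOperator, hab] using hA.tendsto_apply (h g hg hgb) ha
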